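/- Let the scalar field $\mathbb{K}$ be $\mathbb{R}$ or $\mathbb{C}$. For an infinite cardinal $\lambda$ let $\ell_\infty^c(\lambda)$ be the Banach space of all bounded functions $z\colon\{\alpha : \alpha<\lambda\}\to\mathbb{K}$ such that $z(\alpha)\neq 0$ for at most countably many $\alpha<\lambda$, with the supremum norm. Call a Banach space $X$ complementably homogeneous if every closed subspace $Y$ of $X$ that is isomorphic to $X$ contains a closed subspace $Z$ that is isomorphic to $X$ and complemented in $X$ (that is, $Z$ is the range of a bounded linear projection on $X$). Here isomorphic means linearly homeomorphic. Theorem. For every infinite cardinal $\lambda$, the Banach space $\ell_\infty^c(\lambda)$ is complementably homogeneous. -/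

import Mathlib

open scoped ENNReal Cardinal

universe u

/-- A Banach space `X` over `𝕜` is complementably homogeneous if every closed subspace `Y` of `X`
that is isomorphic to `X` contains a closed subspace `Z` which is isomorphic to `X` and
complemented in `X`, that is, the range of a bounded linear projection on `X`. -/
def ComplementablyHomogeneous (𝕜 X : Type*) [RCLike 𝕜] [NormedAddCommGroup X] [NormedSpace 𝕜 X]
    [CompleteSpace X] : Prop :=
  ∀ Y : Submodule 𝕜 X, IsClosed (Y : Set X) → Nonempty (Y ≃L[𝕜] X) →
    ∃ Z : Submodule 𝕜 X, Z ≤ Y ∧ IsClosed (Z : Set X) ∧ Z.ClosedComplemented ∧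
      Nonempty (Z ≃L[𝕜] X)

/-- The subspace of `ℓ_∞(Γ)` of all functions that are non-zero at at most countably many points
of `Γ`, with the supremum norm inherited from `ℓ_∞(Γ)`. -/
def countableSupport (𝕜 : Type*) [RCLike 𝕜] (Γ : Type*) :
    Submodule 𝕜 (lp (fun _ : Γ => 𝕜) ∞) where
  carrier := {z | {a : Γ | z a ≠ 0}.Countable}
  zero_mem' := by simp
  add_mem' := by
    intro x y hx hy
    refine (Set.Countable.union hx hy).mono fun a ha => ?_
    by_contra h
    simp only [Set.mem_union, Set.mem_ofPred_eq, not_or, not_not] at h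
    exact ha (by simp [h.1, h.2])
  smul_mem' := by
    intro c x hx
    have hx' : {a : Γ | x a ≠ 0}.Countable := hx
    refine hx'.mono fun a ha => ?_
    intro h
    exact ha (by simp [h])

theorem isClosed_countableSupport (𝕜 : Type*) [RCLike 𝕜] (Γ : Type*) :
    IsClosed (countableSupport 𝕜 Γ : Set (lp (fun _ : Γ => 𝕜) ∞)) := by
  refine IsSeqClosed.isClosed fun x z hx hz => ?_
  refine (Set.countable_iUnion fun n => (hx n : {a : Γ | x n a ≠ 0}.Countable)).mono fun a ha => ?_
  by_contra h
  simp only [Set.mem_iUnion, Set.mem_ofPred_eq, not_exists, not_not] at h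
  refine ha (norm_le_zero_iff.1 (le_of_tendsto_of_tendsto' tendsto_const_nhds
    (tendsto_iff_norm_sub_tendsto_zero.1 hz) fun n => ?_))
  have h1 := lp.norm_apply_le_norm ENNReal.top_ne_zero (x n - z) a
  simpa [h n] using h1

instance (𝕜 : Type*) [RCLike 𝕜] (Γ : Type*) : CompleteSpace (countableSupport 𝕜 Γ) :=
  (isClosed_countableSupport 𝕜 Γ).completeSpace_coe

/-- The Banach space `ℓ_∞^c(κ)` for a cardinal `κ`: bounded scalar functions with countable
support on the set of all ordinals `α < κ` (cardinals being identified with initial ordinals). -/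
abbrev EllInftyC (𝕜 : Type*) [RCLike 𝕜] (κ : Cardinal.{u}) : Type _ :=
  countableSupport 𝕜 {α : Ordinal.{u} // α < κ.ord}

/-! An isomorphism of the space onto `Y` is an operator `T` that is bounded below, say by `c`. If `R
T J = 1`, then `T J R` is a projection onto a copy of the space inside `Y`, so it suffices to factor
the identity through `T`. Each `T e_a` has a coordinate `β a` of modulus above `c / 2`. Rosenthal's
lemma, applied to the functionals `x ↦ (T x) (β a)`, gives as many indices as `Γ` has on which each
functional nearly ignores the other chosen coordinates. Extending by zero from these indices,
applying `T`, then reading off and normalizing the coordinates `β a` gives an operator within `1 /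
2` of the identity, hence invertible. -/

section NormedSpace

variable {𝕜 X : Type*} [RCLike 𝕜] [NormedAddCommGroup X] [NormedSpace 𝕜 X] [CompleteSpace X]

/-- An operator that is close to the identity has a bounded left inverse. -/
theorem exists_leftInverse_of_norm_sub_le (S : X →L[𝕜] X) {r : ℝ} (hr : r < 1)
    (hS : ∀ x, ‖x - S x‖ ≤ r * ‖x‖) : ∃ V : X →L[𝕜] X, ∀ x, V (S x) = x := by
  have h : ‖1 - S‖ < 1 := by
    refine (ContinuousLinearMap.opNorm_le_bound _ (le_max_right r 0) fun x => ?_).trans_lt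
      (max_lt hr zero_lt_one)
    exact (hS x).trans (mul_le_mul_of_nonneg_right (le_max_left _ _) (norm_nonneg _))
  let u := Units.oneSub (1 - S) h
  have hu : (u : X →L[𝕜] X) = S := by simp [u]
  refine ⟨(↑u⁻¹ : X →L[𝕜] X), fun x => ?_⟩
  have := congrArg (fun V : X →L[𝕜] X => V x) u.inv_mul
  rwa [hu] at this

/-- A Banach space is complementably homogeneous if the identity factors through every
operator on it that is bounded below. -/
theorem complementablyHomogeneous_of_leftInverse
    (h : ∀ (T : X →L[𝕜] X) (c : ℝ), 0 < c → (∀ x, c * ‖x‖ ≤ ‖T x‖) →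
      ∃ J R : X →L[𝕜] X, ∀ x, R (T (J x)) = x) :
    ComplementablyHomogeneous 𝕜 X := by
  rintro Y - ⟨e⟩
  let T : X →L[𝕜] X :=
    Y.subtypeL.comp (e.symm : X →L[𝕜] Y)
  let C : ℝ := ‖(e : Y →L[𝕜] X)‖ + 1
  have hC : 0 < C := by positivity
  have hT : ∀ x, C⁻¹ * ‖x‖ ≤ ‖T x‖ := fun x => by
    rw [inv_mul_le_iff₀ hC]
    have he := (e : Y →L[𝕜] X).le_opNorm (e.symm x)
    rw [ContinuousLinearEquiv.coe_coe, e.apply_symm_apply] at he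
    refine he.trans (mul_le_mul_of_nonneg_right ?_ (norm_nonneg _))
    exact le_add_of_nonneg_right zero_le_one
  obtain ⟨J, R, hR⟩ := h T C⁻¹ (inv_pos.2 hC) hT
  let U := T.comp J
  have hU : Function.LeftInverse R U := hR
  have hcompl : U.range.ClosedComplemented := by
    refine ⟨U.rangeRestrict.comp R, ?_⟩
    rintro ⟨_, x, rfl⟩
    exact Subtype.ext (congrArg U (hR x))
  refine ⟨U.range, ?_, hcompl.isClosed, hcompl, ⟨(ContinuousLinearEquiv.equivOfInverse
    U.rangeRestrict (R.comp U.range.subtypeL) hU ?_).symm⟩⟩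
  · rintro _ ⟨x, rfl⟩
    exact (e.symm (J x)).2
  · rintro ⟨_, x, rfl⟩
    exact Subtype.ext (congrArg U (hR x))

end NormedSpace

/-! ### Coordinates and basic operators -/

namespace CountableSupport

variable {𝕜 : Type*} [RCLike 𝕜] {Γ Δ : Type*}

noncomputable local instance : NormedAddCommGroup (countableSupport 𝕜 Γ) :=
  Submodule.normedAddCommGroup _

noncomputable local instance : NormedSpace 𝕜 (countableSupport 𝕜 Γ) :=
  Submodule.normedSpace _

theorem norm_apply_le (x : countableSupport 𝕜 Γ) (a : Γ) : ‖x.1 a‖ ≤ ‖x‖ :=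
  lp.norm_apply_le_norm ENNReal.top_ne_zero x.1 a

theorem norm_le_of_forall_le {x : countableSupport 𝕜 Γ} {C : ℝ} (hC : 0 ≤ C)
    (h : ∀ a, ‖x.1 a‖ ≤ C) : ‖x‖ ≤ C :=
  lp.norm_le_of_forall_le hC h

theorem ext_apply {x y : countableSupport 𝕜 Γ} (h : ∀ a, x.1 a = y.1 a) : x = y :=
  Subtype.ext (lp.ext (funext h))

/-- A bounded function with countable support as an element of `countableSupport 𝕜 Γ`. -/
def ofBounded (x : Γ → 𝕜) (C : ℝ) (hC : ∀ a, ‖x a‖ ≤ C) (hx : {a | x a ≠ 0}.Countable) :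
    countableSupport 𝕜 Γ :=
  ⟨⟨x, memℓp_infty ⟨C, by rintro _ ⟨a, rfl⟩; exact hC a⟩⟩, hx⟩

@[simp] theorem ofBounded_apply (x : Γ → 𝕜) (C : ℝ) (hC : ∀ a, ‖x a‖ ≤ C)
    (hx : {a | x a ≠ 0}.Countable) (a : Γ) : (ofBounded x C hC hx).1 a = x a := rfl

theorem add_apply (x y : countableSupport 𝕜 Γ) (a : Γ) :
    (x + y).1 a = x.1 a + y.1 a := rfl

theorem sub_apply (x y : countableSupport 𝕜 Γ) (a : Γ) :
    (x - y).1 a = x.1 a - y.1 a := rfl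

theorem smul_apply (c : 𝕜) (x : countableSupport 𝕜 Γ) (a : Γ) :
    (c • x).1 a = c * x.1 a := rfl

/-- The evaluation functional at a point. -/
noncomputable def eval (a : Γ) : countableSupport 𝕜 Γ →L[𝕜] 𝕜 :=
  LinearMap.mkContinuous
    { toFun := fun x => x.1 a
      map_add' := fun _ _ => rfl
      map_smul' := fun _ _ => rfl } 1 fun x => by
      rw [one_mul]; exact norm_apply_le x a

open Classical in
/-- The unit vector at a point. -/
noncomputable def unitVec (a : Γ) : countableSupport 𝕜 Γ :=
  ofBounded (Pi.single a 1) 1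
    (fun b => by by_cases h : b = a <;> simp [h])
    ((Set.countable_singleton a).mono fun b hb => by
      by_contra h
      exact hb (by simp [show b ≠ a from h]))

@[simp] theorem unitVec_self (a : Γ) : (unitVec a : countableSupport 𝕜 Γ).1 a = 1 := by
  simp [unitVec]

theorem unitVec_of_ne {a b : Γ} (h : b ≠ a) : (unitVec a : countableSupport 𝕜 Γ).1 b = 0 := by
  simp [unitVec, h]

theorem norm_unitVec (a : Γ) : ‖(unitVec a : countableSupport 𝕜 Γ)‖ = 1 := by
  refine le_antisymm (norm_le_of_forall_le zero_le_one fun b => ?_) ?_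
  · by_cases h : b = a
    · simp [h]
    · simp [unitVec_of_ne h]
  · simpa using norm_apply_le (unitVec a : countableSupport 𝕜 Γ) a

theorem norm_extend_le (φ : Γ → Δ) (hφ : φ.Injective) (x : countableSupport 𝕜 Γ) (b : Δ) :
    ‖Function.extend φ x.1 (0 : Δ → 𝕜) b‖ ≤ ‖x‖ := by
  by_cases h : ∃ a, φ a = b
  · obtain ⟨a, rfl⟩ := h
    rw [hφ.extend_apply]
    exact norm_apply_le x a
  · rw [Function.extend_apply' _ _ _ h]
    simp

/-- Extension by zero along an injective map, as a linear map. -/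
noncomputable def extendByZeroLinear (φ : Γ → Δ) (hφ : φ.Injective) :
    countableSupport 𝕜 Γ →ₗ[𝕜] countableSupport 𝕜 Δ where
  toFun x := ofBounded (Function.extend φ x.1 (0 : Δ → 𝕜)) ‖x‖ (norm_extend_le φ hφ x) <| by
    refine (Set.Countable.image (s := {a | x.1 a ≠ 0}) x.2 φ).mono fun b hb => ?_
    by_cases h : ∃ a, φ a = b
    · obtain ⟨a, rfl⟩ := h
      exact ⟨a, by simpa [hφ.extend_apply] using hb, rfl⟩
    · exact (hb (by rw [Function.extend_apply' _ _ _ h]; rfl)).elim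
  map_add' x y := ext_apply fun b => by
    by_cases h : ∃ a, φ a = b
    · obtain ⟨a, rfl⟩ := h
      simp only [add_apply, ofBounded_apply, hφ.extend_apply]
    · simp only [add_apply, ofBounded_apply, Function.extend_apply' _ _ _ h, Pi.zero_apply,
        add_zero]
  map_smul' c x := ext_apply fun b => by
    by_cases h : ∃ a, φ a = b
    · obtain ⟨a, rfl⟩ := h
      simp only [smul_apply, ofBounded_apply, hφ.extend_apply, RingHom.id_apply]
    · simp only [smul_apply, ofBounded_apply, Function.extend_apply' _ _ _ h, Pi.zero_apply,
        mul_zero]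

theorem norm_extendByZeroLinear_le (φ : Γ → Δ) (hφ : φ.Injective) (x : countableSupport 𝕜 Γ) :
    ‖extendByZeroLinear φ hφ x‖ ≤ 1 * ‖x‖ := by
  rw [one_mul]
  exact norm_le_of_forall_le (norm_nonneg x) (norm_extend_le φ hφ x)

/-- Extension by zero along an injective map. -/
noncomputable def extendByZero (φ : Γ → Δ) (hφ : φ.Injective) :
    countableSupport 𝕜 Γ →L[𝕜] countableSupport 𝕜 Δ :=
  (extendByZeroLinear (𝕜 := 𝕜) φ hφ).mkContinuous 1 (norm_extendByZeroLinear_le φ hφ)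

theorem extendByZero_apply {φ : Γ → Δ} (hφ : φ.Injective) (x : countableSupport 𝕜 Γ) (a : Γ) :
    (extendByZero φ hφ x).1 (φ a) = x.1 a :=
  hφ.extend_apply _ _ a

theorem extendByZero_of_notMem_range {φ : Γ → Δ} (hφ : φ.Injective) (x : countableSupport 𝕜 Γ)
    {b : Δ} (hb : b ∉ Set.range φ) : (extendByZero φ hφ x).1 b = 0 :=
  Function.extend_apply' _ _ _ hb

/-- Composition with an injective map followed by multiplication by a bounded function. -/
noncomputable def weightedComp (σ : Γ → Δ) (hσ : σ.Injective) (w : Γ → 𝕜) (C : ℝ)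
    (hw : ∀ a, ‖w a‖ ≤ C) : countableSupport 𝕜 Δ →L[𝕜] countableSupport 𝕜 Γ :=
  have hb (y : countableSupport 𝕜 Δ) (a : Γ) : ‖w a * y.1 (σ a)‖ ≤ C * ‖y‖ := by
    rw [norm_mul]
    exact mul_le_mul (hw a) (norm_apply_le y _) (norm_nonneg _) ((norm_nonneg _).trans (hw a))
  LinearMap.mkContinuous
    { toFun := fun y => ofBounded (fun a => w a * y.1 (σ a)) (C * ‖y‖) (hb y) <|
        (Set.Countable.preimage_of_injOn (s := {b | y.1 b ≠ 0}) y.2 hσ.injOn).mono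
          fun a (ha : w a * y.1 (σ a) ≠ 0) => right_ne_zero_of_mul ha
      map_add' := fun x y => ext_apply fun a => by simp only [add_apply, ofBounded_apply, mul_add]
      map_smul' := fun c x => ext_apply fun a => by
        simp only [smul_apply, ofBounded_apply, RingHom.id_apply, mul_left_comm] } (max C 0)
    fun y => norm_le_of_forall_le (by positivity) fun a =>
      (hb y a).trans (mul_le_mul_of_nonneg_right (le_max_left _ _) (norm_nonneg _))

/-! ### Variation of functionals -/

/-- The total variation of the functional `f` on the set `S` is at most `r`. -/
def VariationLE (f : countableSupport 𝕜 Γ →L[𝕜] 𝕜) (S : Set Γ) (r : ℝ) : Prop :=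
  ∀ x : countableSupport 𝕜 Γ, ‖x‖ ≤ 1 → (∀ a ∉ S, x.1 a = 0) → ‖f x‖ ≤ r

theorem VariationLE.norm_le {f : countableSupport 𝕜 Γ →L[𝕜] 𝕜} {S : Set Γ} {r : ℝ}
    (h : VariationLE f S r) {x : countableSupport 𝕜 Γ} {C : ℝ} (hx : ‖x‖ ≤ C)
    (hS : ∀ a ∉ S, x.1 a = 0) : ‖f x‖ ≤ r * C := by
  rcases (norm_nonneg x).eq_or_lt with h0 | h0
  · have hr : 0 ≤ r := by
      have := h 0 (by rw [norm_zero]; exact zero_le_one) (fun _ _ => rfl)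
      rwa [f.map_zero, norm_zero] at this
    have hx0 : x = 0 := norm_eq_zero.1 h0.symm
    rw [hx0, f.map_zero, norm_zero]
    exact mul_nonneg hr (h0.le.trans hx)
  · have hC : 0 < C := h0.trans_le hx
    have := h (((C⁻¹ : ℝ) : 𝕜) • x)
      (by
        rw [norm_smul, RCLike.norm_ofReal, abs_of_pos (inv_pos.2 hC), inv_mul_le_one₀ hC]
        exact hx)
      (fun a ha => by rw [smul_apply, hS a ha, mul_zero])
    rwa [f.map_smul, norm_smul, RCLike.norm_ofReal, abs_of_pos (inv_pos.2 hC),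
      inv_mul_le_iff₀ hC, mul_comm] at this

theorem exists_norm_eq_one_mul_eq_norm (z : 𝕜) : ∃ u : 𝕜, ‖u‖ = 1 ∧ u * z = (‖z‖ : 𝕜) := by
  by_cases hz : z = 0
  · exact ⟨1, by simp, by simp [hz]⟩
  · have h : ‖z‖ ≠ 0 := norm_ne_zero_iff.2 hz
    refine ⟨(‖z‖ : 𝕜) / z, by simp [h], by field_simp⟩

/-- Total variation is additive on disjoint sets, in the form of the inequality that bounds the
variation on one of them. -/
theorem VariationLE.of_disjoint {f : countableSupport 𝕜 Γ →L[𝕜] 𝕜} {S S' U : Set Γ} {r ε : ℝ}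
    (h : VariationLE f U (r + ε)) (hS : S ⊆ U) (hS' : S' ⊆ U) (hd : Disjoint S S')
    (hf : ¬ VariationLE f S ε) : VariationLE f S' r := by
  simp only [VariationLE, not_forall, not_le] at hf
  obtain ⟨x, hx1, hxS, hx⟩ := hf
  intro y hy1 hyS
  -- Unimodular factors align the two values, so that their moduli add; disjoint supports keep the
  -- norm of the sum at most 1.
  obtain ⟨u, hu, hux⟩ := exists_norm_eq_one_mul_eq_norm (f x)
  obtain ⟨v, hv, hvy⟩ := exists_norm_eq_one_mul_eq_norm (f y)
  have key := h (u • x + v • y)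
    (norm_le_of_forall_le zero_le_one fun a => by
      rw [add_apply, smul_apply, smul_apply]
      by_cases ha : a ∈ S
      · have := hyS a (Set.disjoint_left.1 hd ha)
        simpa [this, hu] using (norm_apply_le x a).trans hx1
      · simpa [hxS a ha, hv] using (norm_apply_le y a).trans hy1)
    (fun a ha => by
      rw [add_apply, smul_apply, smul_apply, hxS a fun h => ha (hS h), hyS a fun h => ha (hS' h),
        mul_zero, mul_zero, add_zero])
  have hsum : f (u • x + v • y) = ((‖f x‖ + ‖f y‖ : ℝ) : 𝕜) := by
    rw [f.map_add, f.map_smul, f.map_smul, smul_eq_mul, smul_eq_mul, hux, hvy, RCLike.ofReal_add]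
  rw [hsum, RCLike.norm_ofReal, abs_of_nonneg (by positivity)] at key
  linarith

/-! ### Rosenthal's lemma -/

theorem nonempty_prod_self_equiv (Γ : Type*) [Infinite Γ] : Nonempty (Γ × Γ ≃ Γ) :=
  Cardinal.eq.1 (by simp)

/-- Split the index set into `Γ` many rows of size `Γ`. Either some row already works, or each row
has a bad index; along the transversal of bad indices every functional has lost `ε` of its variation
to its own row. At most `n` such losses can occur. -/
theorem exists_injective_variationLE_of_nat [Infinite Γ] {f : Γ → countableSupport 𝕜 Γ →L[𝕜] 𝕜}
    {ε : ℝ} (hε : 0 ≤ ε) (n : ℕ) : ∀ φ : Γ → Γ, φ.Injective →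
      (∀ i, VariationLE (f (φ i)) (Set.range φ \ {φ i}) (n * ε)) →
      ∃ ψ : Γ → Γ, ψ.Injective ∧ ∀ i, VariationLE (f (ψ i)) (Set.range ψ \ {ψ i}) ε := by
  induction n with
  | zero =>
    intro φ hφ h
    exact ⟨φ, hφ, fun i x hx hS => (h i x hx hS).trans (by simpa using hε)⟩
  | succ n ih =>
    intro φ hφ h
    obtain ⟨p⟩ := nonempty_prod_self_equiv Γ
    have hinj {i j i' j' : Γ} (hij : φ (p (i, j)) = φ (p (i', j'))) : i = i' ∧ j = j' := by
      simpa using p.injective (hφ hij)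
    by_cases hgood : ∃ i, ∀ j, VariationLE (f (φ (p (i, j))))
        (Set.range (fun k => φ (p (i, k))) \ {φ (p (i, j))}) ε
    · obtain ⟨i, hi⟩ := hgood
      exact ⟨fun j => φ (p (i, j)), fun j k hjk => (hinj hjk).2, hi⟩
    · push Not at hgood
      choose j hj using hgood
      refine ih (fun i => φ (p (i, j i))) (fun i k hik => (hinj hik).1) fun i => ?_
      have hi := h (p (i, j i))
      rw [Nat.cast_succ, add_mul, one_mul] at hi
      refine hi.of_disjoint ?_ ?_ ?_ (hj i)
      · rintro _ ⟨⟨k, rfl⟩, hk⟩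
        exact ⟨⟨_, rfl⟩, hk⟩
      · rintro _ ⟨⟨k, rfl⟩, hk⟩
        exact ⟨⟨_, rfl⟩, hk⟩
      -- The transversal meets row `i` only at its own index, which is removed from both sets.
      · rw [Set.disjoint_left]
        rintro _ ⟨⟨k, rfl⟩, _⟩ ⟨⟨l, hl⟩, hl'⟩
        obtain rfl := (hinj hl).1
        exact hl' hl.symm

/-- **Rosenthal's lemma** for uniformly bounded families of functionals on `countableSupport 𝕜 Γ`:
on the image of some injective self-map of `Γ` each functional is concentrated at its own
index up to `ε`. -/
theorem exists_injective_variationLE [Infinite Γ] {f : Γ → countableSupport 𝕜 Γ →L[𝕜] 𝕜}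
    {M ε : ℝ} (hf : ∀ a x, ‖f a x‖ ≤ M * ‖x‖) (hε : 0 < ε) :
    ∃ ψ : Γ → Γ, ψ.Injective ∧ ∀ i, VariationLE (f (ψ i)) (Set.range ψ \ {ψ i}) ε := by
  obtain ⟨n, hn⟩ := exists_nat_ge (M / ε)
  rw [div_le_iff₀ hε] at hn
  refine exists_injective_variationLE_of_nat hε.le n id Function.injective_id fun i x hx _ => ?_
  by_cases hM : 0 ≤ M
  · calc ‖f i x‖ ≤ M * ‖x‖ := hf i x
      _ ≤ M * 1 := by gcongr
      _ ≤ n * ε := by rwa [mul_one]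
  · exact (hf i x).trans ((mul_nonpos_of_nonpos_of_nonneg (not_le.1 hM).le (norm_nonneg x)).trans
      (by positivity))

/-! ### Factorization of the identity -/

/-- An operator on `countableSupport 𝕜 Γ` that is bounded below fixes a complemented copy of the
space. -/
theorem exists_comp_comp_eq_id [Infinite Γ]
    (T : countableSupport 𝕜 Γ →L[𝕜] countableSupport 𝕜 Γ) {c : ℝ} (hc : 0 < c)
    (hT : ∀ x, c * ‖x‖ ≤ ‖T x‖) :
    ∃ J R : countableSupport 𝕜 Γ →L[𝕜] countableSupport 𝕜 Γ,
      ∀ x, R (T (J x)) = x := by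
  have hβ : ∀ a : Γ, ∃ b : Γ, c / 2 < ‖(T (unitVec a)).1 b‖ := by
    intro a
    by_contra! h
    have h1 := norm_le_of_forall_le (by positivity) h
    have h2 := hT (unitVec a)
    rw [norm_unitVec] at h2
    linarith
  choose β hβ using hβ
  let f (a : Γ) : countableSupport 𝕜 Γ →L[𝕜] 𝕜 := (eval (β a)).comp T
  obtain ⟨M, -, hM⟩ := T.bound
  have hf : ∀ a x, ‖f a x‖ ≤ M * ‖x‖ := fun a x => (norm_apply_le (T x) (β a)).trans (hM x)
  -- The choice `c / 4` is half of the lower bound `c / 2` on the diagonal entries, whence the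
  -- factor `1 / 2` in `hS`.
  obtain ⟨φ, hφ, hvar⟩ := exists_injective_variationLE hf (show 0 < c / 4 by positivity)
  -- If `β (φ i) = β (φ j)` with `i ≠ j`, the functional at `φ i` exceeds `c / 2` on the unit vector
  -- at `φ j`, against its variation bound `c / 4`.
  have hσ : Function.Injective fun i => β (φ i) := by
    intro i j hij
    by_contra hne
    have hne' : φ j ≠ φ i := fun h => hne (hφ h).symm
    have h1 := hvar i (unitVec (φ j)) (norm_unitVec _).le fun a ha =>
      unitVec_of_ne fun h => ha ⟨⟨j, h.symm⟩, by rw [h]; exact hne'⟩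
    have h2 := hβ (φ j)
    have h3 : f (φ i) (unitVec (φ j)) = (T (unitVec (φ j))).1 (β (φ j)) := by
      rw [← show β (φ i) = β (φ j) from hij]; rfl
    rw [h3] at h1
    linarith
  let d (i : Γ) : 𝕜 := (T (unitVec (φ i))).1 (β (φ i))
  have hd : ∀ i, ‖(d i)⁻¹‖ ≤ (c / 2)⁻¹ := fun i => by
    rw [norm_inv]
    exact inv_anti₀ (by positivity) (hβ (φ i)).le
  have hd0 : ∀ i, d i ≠ 0 := fun i =>
    norm_pos_iff.1 ((show 0 < c / 2 by positivity).trans (hβ (φ i)))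
  let J := extendByZero (𝕜 := 𝕜) φ hφ
  let R := weightedComp _ hσ (fun i => (d i)⁻¹) _ hd
  let S := R.comp (T.comp J)
  have hS : ∀ x, ‖x - S x‖ ≤ 1 / 2 * ‖x‖ := fun x => by
    refine norm_le_of_forall_le (by positivity) fun i => ?_
    -- Removing the coordinate `φ i` leaves a vector supported where the variation bound applies.
    let y := J x - x.1 i • unitVec (φ i)
    have hy0 : y.1 (φ i) = 0 := by
      simp only [y, J, sub_apply, smul_apply, extendByZero_apply, unitVec_self, mul_one, sub_self]
    have hyk : ∀ a, a ≠ φ i → y.1 a = (J x).1 a := fun a ha => by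
      simp only [y, sub_apply, smul_apply, unitVec_of_ne ha, mul_zero, sub_zero]
    have hy : ‖f (φ i) y‖ ≤ c / 4 * ‖x‖ := by
      refine (hvar i).norm_le (norm_le_of_forall_le (norm_nonneg x) fun a => ?_) fun a ha => ?_
      · by_cases hai : a = φ i
        · rw [hai, hy0]; simp
        · rw [hyk a hai]
          by_cases har : a ∈ Set.range φ
          · obtain ⟨k, rfl⟩ := har
            rw [extendByZero_apply]
            exact norm_apply_le x k
          · rw [extendByZero_of_notMem_range hφ x har]; simp
      · by_cases hai : a = φ i
        · rw [hai, hy0]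
        · rw [hyk a hai]
          exact extendByZero_of_notMem_range hφ x fun har => ha ⟨har, hai⟩
    have hTy : f (φ i) y = (T (J x)).1 (β (φ i)) - x.1 i * d i := by
      have h1 : T y = T (J x) - x.1 i • T (unitVec (φ i)) := by rw [T.map_sub, T.map_smul]
      have h2 : f (φ i) y = (T y).1 (β (φ i)) := rfl
      rw [h2, h1, sub_apply, smul_apply]
    have hval : (x - S x).1 i = -((d i)⁻¹ * f (φ i) y) := by
      have h1 : (x - S x).1 i = x.1 i - (d i)⁻¹ * (T (J x)).1 (β (φ i)) := rfl
      rw [h1, hTy, mul_sub, mul_left_comm, inv_mul_cancel₀ (hd0 i)]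
      ring
    rw [hval, norm_neg, norm_mul]
    calc ‖(d i)⁻¹‖ * ‖f (φ i) y‖ ≤ (c / 2)⁻¹ * (c / 4 * ‖x‖) := by
          gcongr
          exact hd i
      _ = 1 / 2 * ‖x‖ := by field_simp; norm_num
  obtain ⟨V, hV⟩ := exists_leftInverse_of_norm_sub_le S (by norm_num) hS
  exact ⟨J, V.comp R, hV⟩

theorem complementablyHomogeneous_countableSupport [Infinite Γ] :
    ComplementablyHomogeneous 𝕜 (countableSupport 𝕜 Γ) := by
  exact complementablyHomogeneous_of_leftInverse fun T _ hc hT => exists_comp_comp_eq_id T hc hT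

end CountableSupport

theorem theorem1p3 (𝕜 : Type*) [RCLike 𝕜] (κ : Cardinal.{u}) (hκ : ℵ₀ ≤ κ) :
    ComplementablyHomogeneous 𝕜 (EllInftyC 𝕜 κ) := by
  have : Infinite {α : Ordinal.{u} // α < κ.ord} := by
    rw [Cardinal.infinite_iff]
    have h : Cardinal.mk {α : Ordinal.{u} // α < κ.ord} = Cardinal.lift.{u + 1} κ := by
      rw [← Cardinal.card_ord κ, ← Cardinal.mk_Iio_ordinal, Cardinal.card_ord]
      rfl
    rw [h]
    simpa using hκ
  exact CountableSupport.complementablyHomogeneous_countableSupport
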